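/- Let $F$ be any field, $n,k\ge 0$ integers, and $\mathbb{L}=\mathbb{Z}^n$. A sublattice is a subgroup $\mathbb{S}\subseteq\mathbb{L}$; for $d\in\mathbb{Z}_{\ge 0}^n$ the diagonal sublattice $\mathbb{L}_d$ is $\{x\in\mathbb{Z}^n : x_i\in d_i\mathbb{Z}\ \text{for all } i\}$, and it has full rank if and only if all $d_i>0$. Let $A_{\mathbb{S}}=F[\mathbb{S}]$ be the group algebra of $\mathbb{S}$ (for $\mathbb{S}=\mathbb{L}$ the Laurent polynomial ring $F[\sigma_1^{\pm1},\dots,\sigma_n^{\pm1}]$), acting on functions $f:\mathbb{S}\to F$ by shifts, $\bigl((\sum_z a_z\sigma^z) f\bigr)(x)=\sum_z a_z f(x+z)$. A system on $\mathbb{S}$ is a set of the form $$\mathrm{Ker}(P)=\Bigl\{f\in (F^{\mathbb{S}})^k : \sum_{j=1}^k p_jf_j=0\ \text{ for all } p\in P\Bigr\},$$ where $P$ is an $A_{\mathbb{S}}$-submodule of $A_{\mathbb{S}}^k$; a system on $\mathbb{L}$ is called an $n$-D system. The restriction of a system on $\mathbb{S}$ to a sublattice $\mathbb{T}\subseteq\mathbb{S}$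 is the set of restrictions of its elements to $\mathbb{T}$; it is the system $\mathrm{Ker}(P\cap A_{\mathbb{T}}^k)$ on $\mathbb{T}$. A system $\mathcal{B}$ on $\mathbb{S}$ is controllable if there is a real $\rho>0$ such that for all $T_1,T_2\subseteq\mathbb{S}$ with $\|x_1-x_2\|_1>\rho$ for all $x_1\in T_1$, $x_2\in T_2$, and all $f_1,f_2\in\mathcal{B}$, there is $f\in\mathcal{B}$ with $f=f_1$ on $T_1$ and $f=f_2$ on $T_2$. It is autonomous if no nonzero system on $\mathbb{S}$ contained in $\mathcal{B}$ is controllable. The degree of autonomy of a system $\mathcal{B}$ on $\mathbb{S}$ is the co-rank $\operatorname{rank}\mathbb{S}-\operatorname{rank}\mathbb{L}_{d'}$ of a diagonal sublattice $\mathbb{L}_{d'}\subseteq\mathbb{S}$ of largest rank among those such that the restriction of $\mathcal{B}$ to $\mathbb{L}_{d'}$ is not autonomous. If there is no such $\mathbb{L}_{d'}$ (which happens only for $\mathcal{B}=0$), the degree of autonomy is $\infty$ by convention. **Proposition 7.5.** Let $\mathcal{B}$ be an $n$-D system on $\mathbb{L}$, and let $d\in\mathbb{Z}_{\ge 0}^n$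 with all $d_i>0$. Then the degree of autonomy of $\mathcal{B}$ equals the degree of autonomy of its restriction to the full-rank diagonal sublattice $\mathbb{L}_d$. -/

import Mathlib

/-- A sublattice of `ℤⁿ` is an additive subgroup of `Fin n → ℤ`; the whole lattice is `⊤`. -/
abbrev ZSublattice (n : ℕ) : Type := AddSubgroup (Fin n → ℤ)

namespace ZSublattice

/-- The diagonal sublattice `{x | ∀ i, x i ∈ d i • ℤ}` of `ℤⁿ`; it has full rank when all `d i`
are positive. -/
def diag {n : ℕ} (d : Fin n → ℕ) : ZSublattice n where
  carrier := {x | ∀ i, (d i : ℤ) ∣ x i}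
  add_mem' hx hy i := dvd_add (hx i) (hy i)
  zero_mem' _ := dvd_zero _
  neg_mem' hx i := (dvd_neg).mpr (hx i)

/-- The rank of a sublattice, as a free `ℤ`-module. -/
noncomputable def rank {n : ℕ} (S : ZSublattice n) : ℕ := Module.finrank ℤ S

/-- The `ℓ¹` distance between two points of a sublattice of `ℤⁿ`. -/
def dist {n : ℕ} {S : ZSublattice n} (x y : S) : ℤ := ∑ i, |x.1 i - y.1 i|

end ZSublattice

/-- The ring `A_S` of partial difference operators on the sublattice `S`: the group algebra
`F[S]`, whose monomial at `z : S` is the shift by `z`. For `S = ⊤` this is the ring of Laurent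
polynomials in `n` variables over `F`. -/
abbrev DiffOp (F : Type*) [Field F] {n : ℕ} (S : ZSublattice n) : Type _ :=
  AddMonoidAlgebra F S

/-- The `k`-tuples of `F`-valued signals on the sublattice `S`. -/
abbrev Signals (F : Type*) {n : ℕ} (k : ℕ) (S : ZSublattice n) : Type _ :=
  Fin k → S → F

namespace NDSystem

variable {F : Type*} [Field F] {n k : ℕ} {S T : ZSublattice n}

/-- A difference operator acts on a signal by `(a f)(x) = ∑ z, a z * f (x + z)`. -/
noncomputable def act (a : DiffOp F S) (f : S → F) : S → F :=
  fun x => a.coeff.sum fun z c => c * f (x + z)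

lemma act_single (z : S) (c : F) (f : S → F) (x : S) :
    act (AddMonoidAlgebra.single z c) f x = c * f (x + z) := by
  simp [act]

lemma act_zero_left (f : S → F) : act (0 : DiffOp F S) f = 0 := by
  funext x; simp [act]

lemma act_add_left (a b : DiffOp F S) (f : S → F) : act (a + b) f = act a f + act b f := by
  funext x
  simp only [act, AddMonoidAlgebra.coeff_add, Pi.add_apply]
  exact Finsupp.sum_add_index' (by simp) (by intros; ring)

lemma act_zero_right (a : DiffOp F S) : act a (0 : S → F) = 0 := by
  funext x; simp [act]

lemma act_add_right (a : DiffOp F S) (f g : S → F) : act a (f + g) = act a f + act a g := by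
  funext x
  simp [act, mul_add, Finsupp.sum_add]

lemma act_smul_right (a : DiffOp F S) (c : F) (f : S → F) : act a (c • f) = c • act a f := by
  funext x
  simp only [act, Pi.smul_apply, smul_eq_mul, Finsupp.mul_sum]
  exact Finsupp.sum_congr fun z _ => by ring

/-- `Ker(P)`: the `k`-tuples of signals on `S` annihilated by every law `p` in the submodule `P`
of `A_S ^ k`, where `p` acts by `f ↦ ∑ j, p j f j`. -/
noncomputable def ker (P : Submodule (DiffOp F S) (Fin k → DiffOp F S)) :
    Submodule F (Signals F k S) where
  carrier := {f | ∀ p ∈ P, ∑ j, act (p j) (f j) = 0}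
  add_mem' hf hg p hp := by
    simp only [Pi.add_apply, act_add_right, Finset.sum_add_distrib]
    rw [hf p hp, hg p hp, add_zero]
  zero_mem' p _ := by simp [act_zero_right]
  smul_mem' c f hf p hp := by
    simp only [Pi.smul_apply, act_smul_right, ← Finset.smul_sum]
    rw [hf p hp, smul_zero]

/-- A system on `S` is a set of trajectories of the form `Ker(P)` with `P` a submodule of
`A_S ^ k`. As `A_S` is Noetherian, `P` is generated by the rows of some finite matrix over `A_S`,
so these are exactly the kernels of matrices of partial difference operators. -/
def IsSystem (B : Submodule F (Signals F k S)) : Prop :=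
  ∃ P : Submodule (DiffOp F S) (Fin k → DiffOp F S), B = ker P

/-- Trajectories can be patched: for some real `ρ > 0` and all sets `T₁`, `T₂` of lattice points at
distance greater than `ρ` from each other, any two trajectories `f₁`, `f₂` admit a trajectory that
agrees with `f₁` on `T₁` and with `f₂` on `T₂`, i.e. `B(T₁ ∪ T₂) = B(T₁) × B(T₂)`. -/
def IsControllable (B : Submodule F (Signals F k S)) : Prop :=
  ∃ ρ : ℝ, 0 < ρ ∧ ∀ T₁ T₂ : Set S,
    (∀ x ∈ T₁, ∀ y ∈ T₂, ρ < (ZSublattice.dist x y : ℝ)) →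
      ∀ f₁ ∈ B, ∀ f₂ ∈ B, ∃ f ∈ B,
        (∀ x ∈ T₁, ∀ j, f j x = f₁ j x) ∧ (∀ x ∈ T₂, ∀ j, f j x = f₂ j x)

/-- No nonzero subsystem is controllable. -/
def IsAutonomous (B : Submodule F (Signals F k S)) : Prop :=
  ∀ B' : Submodule F (Signals F k S), IsSystem B' → B' ≤ B → IsControllable B' → B' = ⊥

/-- Restriction of the signals on `S` to a sublattice `T` of `S`. -/
def restrictMap (h : T ≤ S) : Signals F k S →ₗ[F] Signals F k T where
  toFun f j x := f j (AddSubgroup.inclusion h x)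
  map_add' _ _ := rfl
  map_smul' _ _ := rfl

/-- The restriction of a system on `S` to a sublattice `T` of `S`: the restrictions to `T` of its
trajectories. -/
def restrict (h : T ≤ S) (B : Submodule F (Signals F k S)) : Submodule F (Signals F k T) :=
  B.map (restrictMap h)

/-- The degree of autonomy of a system on `S`: the co-rank in `S` of the largest diagonal
sublattice contained in `S` on which the restriction of the system is not autonomous, in other
words the least co-rank of such a diagonal sublattice. It is `⊤` when there is none, which
happens only for the zero system. -/
noncomputable def degreeOfAutonomy (B : Submodule F (Signals F k S)) : ℕ∞ :=
  sInf {r : ℕ∞ | ∃ (d : Fin n → ℕ) (h : ZSublattice.diag d ≤ S),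
    ¬ IsAutonomous (restrict h B) ∧ r = ((S.rank - (ZSublattice.diag d).rank : ℕ) : ℕ∞)}

/-! ### The restriction of a system is a system -/

/-- The inclusion of `A_T` in `A_S` for `T ≤ S`. -/
noncomputable def inclusionHom (F : Type*) [Field F] (h : T ≤ S) : DiffOp F T →+* DiffOp F S :=
  AddMonoidAlgebra.mapDomainRingHom F (AddSubgroup.inclusion h)

/-- The contraction `P ∩ A_T ^ k` of a submodule `P` of `A_S ^ k`. -/
noncomputable def contract (h : T ≤ S) (P : Submodule (DiffOp F S) (Fin k → DiffOp F S)) :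
    Submodule (DiffOp F T) (Fin k → DiffOp F T) where
  carrier := {q | (fun j => inclusionHom F h (q j)) ∈ P}
  add_mem' {p q} hp hq := by
    have := P.add_mem hp hq
    simpa [Pi.add_def] using! this
  zero_mem' := by
    have := P.zero_mem
    simpa [Pi.zero_def] using! this
  smul_mem' a q hq := by
    have := P.smul_mem (inclusionHom F h a) hq
    simpa [Pi.smul_def] using! this

lemma act_inclusionHom (h : T ≤ S) (a : DiffOp F T) (f : S → F) (x : T) :
    act (inclusionHom F h a) f (AddSubgroup.inclusion h x) =
      act a (fun y => f (AddSubgroup.inclusion h y)) x := by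
  induction a using AddMonoidAlgebra.induction_linear with
  | zero => simp [act_zero_left]
  | add a b ha hb => simp only [map_add, act_add_left, Pi.add_apply, ha, hb]
  | single z c => simp [inclusionHom, act_single]

lemma act_eq_of_functional (ψ : (Fin k → DiffOp F S) →ₗ[F] F) (a : DiffOp F S) (j : Fin k)
    (x : S) :
    act a (fun y => ψ (Pi.single j (AddMonoidAlgebra.single y 1))) x =
      ψ (Pi.single j (AddMonoidAlgebra.single x 1 * a)) := by
  induction a using AddMonoidAlgebra.induction_linear with
  | zero => simp [act_zero_left]
  | add a b ha hb => simp only [mul_add, Pi.single_add, map_add, act_add_left, Pi.add_apply, ha, hb]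
  | single z c =>
    rw [act_single, AddMonoidAlgebra.single_mul_single, one_mul, ← smul_eq_mul, ← map_smul,
      ← Pi.single_smul]
    simp

/-- The restriction of `Ker(P)` to `T` is the system `Ker(P ∩ A_T ^ k)`. -/
theorem restrict_ker (h : T ≤ S) (P : Submodule (DiffOp F S) (Fin k → DiffOp F S)) :
    restrict h (ker P) = ker (contract h P) := by
  apply le_antisymm
  · rintro _ ⟨f, hf, rfl⟩ q hq
    funext x
    have := congrFun (hf _ hq) (AddSubgroup.inclusion h x)
    simp only [Finset.sum_apply, Pi.zero_apply] at this ⊢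
    rw [← this]
    exact Finset.sum_congr rfl fun j _ => (act_inclusionHom h (q j) (f j) x).symm
  · intro g hg
    let φ : (Fin k → DiffOp F T) →ₗ[F] F :=
      { toFun := fun q => ∑ j, act (q j) (g j) 0
        map_add' := fun p q => by
          simp [act_add_left, Finset.sum_add_distrib]
        map_smul' := fun c q => by
          simp only [act, Pi.smul_apply, AddMonoidAlgebra.coeff_smul, RingHom.id_apply,
            smul_eq_mul, Finset.mul_sum]
          refine Finset.sum_congr rfl fun j _ => ?_
          rw [Finsupp.sum_smul_index (by simp), Finsupp.mul_sum]
          exact Finsupp.sum_congr fun z _ => by ring }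
    let u : (Fin k → DiffOp F T) →ₗ[F] (Fin k → DiffOp F S) :=
      { toFun := fun q j => inclusionHom F h (q j)
        map_add' := fun p q => by funext j; simp
        map_smul' := fun c q => by
          funext j
          exact (AddMonoidAlgebra.mapDomainLinearMap F F (AddSubgroup.inclusion h)).map_smul c (q j) }
    let m := (P.restrictScalars F).mkQ ∘ₗ u
    have hφ : φ ∈ m.ker.dualAnnihilator := by
      rw [Submodule.mem_dualAnnihilator]
      intro q hq
      have hq' : q ∈ contract h P := by
        have : u q ∈ P.restrictScalars F := by simpa [m] using hq
        exact this
      simpa [φ] using congrFun (hg q hq') 0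
    rw [← LinearMap.range_dualMap_eq_dualAnnihilator_ker] at hφ
    obtain ⟨χ, hχ⟩ := hφ
    let ψ : (Fin k → DiffOp F S) →ₗ[F] F := χ ∘ₗ (P.restrictScalars F).mkQ
    have hψP : ∀ p ∈ P, ψ p = 0 := by
      intro p hp
      have : (P.restrictScalars F).mkQ p = 0 := by simpa using hp
      simp only [ψ, LinearMap.comp_apply, this, map_zero]
    have hψu : ∀ q, ψ (u q) = φ q := fun q => by rw [← hχ]; rfl
    refine ⟨fun j x => ψ (Pi.single j (AddMonoidAlgebra.single x 1)), ?_, ?_⟩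
    · intro p hp
      funext x
      simp only [Finset.sum_apply, act_eq_of_functional, Pi.zero_apply]
      rw [← map_sum, ← hψP _ (P.smul_mem (AddMonoidAlgebra.single x 1) hp)]
      congr 1
      exact Finset.univ_sum_single (AddMonoidAlgebra.single x (1 : F) • p)
    · funext j y
      have hu : u (Pi.single j (AddMonoidAlgebra.single y 1)) =
          Pi.single j (AddMonoidAlgebra.single (AddSubgroup.inclusion h y) 1) := by
        funext i
        rcases eq_or_ne i j with rfl | hij
        · simp [u, inclusionHom]
        · simp [u, hij]
      change ψ _ = _
      rw [← hu, hψu]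
      change ∑ i, act (Pi.single (M := fun _ => DiffOp F T) j (AddMonoidAlgebra.single y 1) i)
        (g i) 0 = g j y
      rw [Finset.sum_eq_single j]
      · simp [act_single]
      · intro i _ hij
        simp [hij, act_zero_left]
      · simp

theorem IsSystem.restrict {B : Submodule F (Signals F k S)} (hB : IsSystem B) (h : T ≤ S) :
    IsSystem (restrict h B) := by
  obtain ⟨P, rfl⟩ := hB
  exact ⟨contract h P, restrict_ker h P⟩

end NDSystem

/-! Both degrees are infima of co-ranks, so it suffices to match witnessing sublattices of equal
co-rank. As `diag d` has full rank, a witness inside `diag d` is already one for the whole lattice.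
Conversely, a witness `diag e` is shrunk to `diag (d * e)`, which lies in `diag d` and has the same
rank as `diag e`. Non-autonomy survives the shrinking (`not_isAutonomous_restrict`): a nonzero
controllable subsystem restricts to a nonzero controllable system. -/

namespace ZSublattice

variable {n : ℕ}

lemma diag_one : diag (1 : Fin n → ℕ) = ⊤ := by
  ext x
  simp [diag, ← SetLike.mem_coe]

lemma diag_mul_le_left (d e : Fin n → ℕ) : diag (d * e) ≤ diag d := fun x hx i =>
  (Dvd.intro (e i : ℤ) (by simp)).trans (hx i)

lemma diag_mul_le_right (d e : Fin n → ℕ) : diag (d * e) ≤ diag e := fun x hx i =>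
  (Dvd.intro_left (d i : ℤ) (by simp)).trans (hx i)

/-- Componentwise multiplication by a positive vector `d` maps `diag e` isomorphically onto
`diag (d * e)`. -/
noncomputable def diagMulEquiv (d e : Fin n → ℕ) (hd : ∀ i, 0 < d i) :
    diag e ≃+ diag (d * e) :=
  AddEquiv.ofBijective
    (AddMonoidHom.mk' (fun x : diag e =>
        (⟨fun i => d i * x.1 i, fun i => by
          simpa using! mul_dvd_mul_left (d i : ℤ) (x.2 i)⟩ : diag (d * e)))
      fun x y => by
        ext i
        exact mul_add _ _ _)
    ⟨fun x y hxy => by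
      ext i
      have h := congrFun (congrArg Subtype.val hxy) i
      exact mul_left_cancel₀ (by exact_mod_cast (hd i).ne') h,
    fun y => by
      have h (i : Fin n) : ∃ c : ℤ, y.1 i = d i * (e i * c) := by
        obtain ⟨c, hc⟩ := y.2 i
        exact ⟨c, by rw [hc]; simp [mul_assoc]⟩
      choose c hc using h
      refine ⟨⟨fun i => e i * c i, fun i => dvd_mul_right _ _⟩, ?_⟩
      ext i
      exact (hc i).symm⟩

/-- Only `d` must be positive: `e` may vanish in some coordinates, so this also covers sublattices
of lower rank. -/
lemma rank_diag_mul (d e : Fin n → ℕ) (hd : ∀ i, 0 < d i) :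
    (diag (d * e)).rank = (diag e).rank :=
  (diagMulEquiv d e hd).toIntLinearEquiv.finrank_eq.symm

lemma rank_diag_of_pos (d : Fin n → ℕ) (hd : ∀ i, 0 < d i) :
    (diag d).rank = (⊤ : ZSublattice n).rank := by
  rw [← diag_one, ← rank_diag_mul d 1 hd, mul_one]

end ZSublattice

namespace NDSystem

variable {F : Type*} [Field F] {n k : ℕ} {S T U : ZSublattice n}

lemma act_shift (a : DiffOp F S) (f : S → F) (s x : S) :
    act a (fun y => f (s + y)) x = act a f (s + x) := by
  simp only [act, add_assoc]

/-- Systems are invariant under shifts. -/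
lemma IsSystem.shift_mem {B : Submodule F (Signals F k S)} (hB : IsSystem B)
    {f : Signals F k S} (hf : f ∈ B) (s : S) : (fun j y => f j (s + y)) ∈ B := by
  obtain ⟨P, rfl⟩ := hB
  intro p hp
  funext x
  have h := congrFun (hf p hp) (s + x)
  simpa only [Finset.sum_apply, act_shift, Pi.zero_apply] using h

lemma restrict_restrict (hUT : U ≤ T) (hTS : T ≤ S) (B : Submodule F (Signals F k S)) :
    restrict hUT (restrict hTS B) = restrict (hUT.trans hTS) B := by
  rw [restrict, restrict, ← Submodule.map_comp]
  rfl

/-- A nonzero system has nonzero restrictions, as it can be shifted to be nonzero at the origin. -/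
lemma IsSystem.restrict_ne_bot {B : Submodule F (Signals F k S)} (hB : IsSystem B)
    (hne : B ≠ ⊥) (h : T ≤ S) : NDSystem.restrict h B ≠ ⊥ := by
  obtain ⟨f, hf, hf0⟩ := Submodule.exists_mem_ne_zero_of_ne_bot hne
  obtain ⟨j, hj⟩ := Function.ne_iff.mp hf0
  obtain ⟨s, hs⟩ := Function.ne_iff.mp hj
  refine Submodule.ne_bot_iff _ |>.mpr ⟨_, ⟨_, hB.shift_mem hf s, rfl⟩, fun h0 => hs ?_⟩
  simpa [restrictMap] using! congrFun (congrFun h0 j) 0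

/-- The same `ρ` works: the inclusion preserves `ℓ¹` distances, so one patches in `S` on the images
of the two sets and restricts the result. -/
lemma IsControllable.restrict {B : Submodule F (Signals F k S)} (hB : IsControllable B)
    (h : T ≤ S) : IsControllable (NDSystem.restrict h B) := by
  obtain ⟨ρ, hρ, hpatch⟩ := hB
  refine ⟨ρ, hρ, ?_⟩
  rintro T₁ T₂ hT _ ⟨f₁, hf₁, rfl⟩ _ ⟨f₂, hf₂, rfl⟩
  obtain ⟨f, hf, h₁, h₂⟩ := hpatch (AddSubgroup.inclusion h '' T₁) (AddSubgroup.inclusion h '' T₂)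
    (by
      rintro _ ⟨x, hx, rfl⟩ _ ⟨y, hy, rfl⟩
      exact hT x hx y hy) f₁ hf₁ f₂ hf₂
  exact ⟨_, ⟨f, hf, rfl⟩, fun x hx j => h₁ _ ⟨x, hx, rfl⟩ j, fun x hx j => h₂ _ ⟨x, hx, rfl⟩ j⟩

/-- The restriction of a non-autonomous system to a sublattice is not autonomous. -/
lemma not_isAutonomous_restrict {B : Submodule F (Signals F k S)} (hB : ¬ IsAutonomous B)
    (h : T ≤ S) : ¬ IsAutonomous (restrict h B) := by
  simp only [IsAutonomous, not_forall] at hB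
  obtain ⟨B', hsys, hle, hctrl, hne⟩ := hB
  -- The restriction of `B'` contradicts autonomy; that it is again a system rests on
  -- `restrict_ker`.
  exact fun haut => hsys.restrict_ne_bot hne h
    (haut _ (hsys.restrict h) (Submodule.map_mono hle) (hctrl.restrict h))

end NDSystem

theorem proposition7p5 {F : Type*} [Field F] {n k : ℕ}
    (B : Submodule F (Signals F k (⊤ : ZSublattice n))) (hB : NDSystem.IsSystem B)
    (d : Fin n → ℕ) (hd : ∀ i, 0 < d i) :
    NDSystem.degreeOfAutonomy B =
      NDSystem.degreeOfAutonomy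
        (NDSystem.restrict (le_top : ZSublattice.diag d ≤ ⊤) B) := by
  apply le_antisymm
  -- Restricting in two stages is restricting once, so the same `e` serves.
  · apply sInf_le_sInf
    rintro r ⟨e, he, haut, rfl⟩
    rw [NDSystem.restrict_restrict] at haut
    exact ⟨e, le_top, haut, by rw [ZSublattice.rank_diag_of_pos d hd]⟩
  · apply sInf_le_sInf
    rintro r ⟨e, he, haut, rfl⟩
    -- `diag e` need not lie in `diag d`; the product gives a common sublattice without loss of
    -- rank.
    refine ⟨d * e, ZSublattice.diag_mul_le_left d e, ?_, ?_⟩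
    · have h := NDSystem.not_isAutonomous_restrict haut (ZSublattice.diag_mul_le_right d e)
      rw [NDSystem.restrict_restrict] at h ⊢
      exact h
    · rw [ZSublattice.rank_diag_of_pos d hd, ZSublattice.rank_diag_mul d e hd]
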